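/- Let $n\ge 1$, $0<\alpha<1$ and $\beta>0$. Let $E_\alpha(z)=\sum_{k\ge 0} z^k/\Gamma(\alpha k+1)$ be the Mittag-Leffler function, and let $\phi\in C_c^\infty(\mathbb R^n)$ satisfy $\phi(\xi)=1$ for $|\xi|\le 1$ and $\phi(\xi)=0$ for $|\xi|\ge 2$. For $j\in\mathbb Z$ put $\psi_j(\xi)=\phi(\xi/2^j)-\phi(\xi/2^{j-1})$, and for $t>0$ and dyadic $N=2^j$ let \[ K_t^N(x)=\int_{\mathbb R^n} E_\alpha(-it^\alpha|\xi|^\beta)\,\psi_j(\xi)\,e^{ix\cdot\xi}\,d\xi ,\qquad x\in\mathbb R^n. \] Then there exist constants $c,t_0,N_0>0$ (depending only on $n,\alpha,\beta,\phi$) such that for all $t>t_0$ and all dyadic numbers $N=2^j>N_0$, $j\in\mathbb Z$, the function $K_t^N$ is bounded and \[ \sup_{x\in\mathbb R^n}|K_t^N(x)|\ \ge\ c\,\frac{N^n}{1+t^\alpha N^\beta}. \] -/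

import Mathlib

open scoped ContDiff

/-- The one-parameter Mittag-Leffler function `E_α(z) = ∑ z^k / Γ(αk + 1)`. The series converges
absolutely for every `z` when `α > 0`. -/
noncomputable def mittagLeffler (α : ℝ) (z : ℂ) : ℂ :=
  ∑' k : ℕ, z ^ k / (Real.Gamma (α * k + 1) : ℂ)

/-- The dyadic frequency cutoff `ψ_j(ξ) = φ(ξ / 2^j) - φ(ξ / 2^(j-1))`. -/
noncomputable def dyadicCutoff {n : ℕ} (φ : EuclideanSpace ℝ (Fin n) → ℂ) (j : ℤ)
    (ξ : EuclideanSpace ℝ (Fin n)) : ℂ :=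
  φ (((2 : ℝ) ^ j)⁻¹ • ξ) - φ (((2 : ℝ) ^ (j - 1))⁻¹ • ξ)

/-- The kernel localized at frequency `N = 2^j`:
`K_t(x) = ∫ E_α(-i t^α |ξ|^β) ψ_j(ξ) e^{i x·ξ} dξ`. -/
noncomputable def localizedKernel {n : ℕ} (α β : ℝ) (φ : EuclideanSpace ℝ (Fin n) → ℂ)
    (j : ℤ) (t : ℝ) (x : EuclideanSpace ℝ (Fin n)) : ℂ :=
  ∫ ξ : EuclideanSpace ℝ (Fin n),
    mittagLeffler α (-Complex.I * ((t ^ α * ‖ξ‖ ^ β : ℝ) : ℂ)) * dyadicCutoff φ j ξ *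
      Complex.exp (Complex.I * ((inner ℝ x ξ : ℝ) : ℂ))

/-!
Rescaling the frequency by `N = 2 ^ j` turns the kernel at `N⁻¹ y` into `N ^ n` times
`∫ E_α(-i Λ |η| ^ β) ψ(η) e ^ (i y·η) dη`, where `Λ = t ^ α N ^ β` and `ψ` lives on
`1/2 ≤ |η| ≤ 2`. The Mittag-Leffler function decays only to first order on the negative imaginary
axis: `s E_α(-is) → 1 / (i Γ(1-α))` as `s → ∞` (`tendsto_mul_mittagLeffler`). Hence, by dominated
convergence, `Λ` times the rescaled integral tends to a nonzero multiple of
`∫ |η| ^ (-β) ψ(η) e ^ (i y·η) dη` (`tendsto_mul_integral_mittagLeffler`). The function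
`|η| ^ (-β) ψ(η)` is continuous, integrable and equal to `1` on the unit sphere, so Fourier
inversion gives a `y` at which this integral does not vanish (`exists_integral_mul_cexp_ne_zero`).
At that single `y` the kernel is bounded below by `c N ^ n / Λ` once `Λ` is large.

The asymptotics of `E_α` come from contour integrals over the two rays `R + r e ^ (± iθ)`, where
`θ = π / (1 + α)` satisfies `π/2 < θ < π` and `α θ < π/2`. No Cauchy theorem is needed: the
derivative of such an integral in the vertex `R` is a difference of boundary terms at the vertex,
which cancel, so the vertex can be moved down to the origin when the singularity there is integrable
(`hankelIntegral_eq_zero_vertex`). At the origin Hankel's formula for `1/Γ(b)`, `0 < b < 1`, is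
Euler's integral with a complex rate together with the reflection formula; for larger `b` it follows
by integration by parts (`hankelIntegral_cpow`). With a distant vertex the power series of `E_α` can
be summed under the integral sign to
`E_α(z) = (2πi)⁻¹ ∫ e ^ ζ ζ ^ (α - 1) / (ζ ^ α - z) dζ` (`hasSum_mittagLeffler`). For `z = -is` the
denominator does not vanish on the sector, so the vertex can again be moved to the origin, and there
the limit `s → ∞` is taken under the integral sign.
-/

open MeasureTheory Set Filter Topology

/-! ### Integrals along rays and the shift of the vertex -/

/-- The sector `{ζ ≠ 0 : |arg ζ| ≤ θ}` of half-opening `θ = arccos (-κ)`, written without `arg`. -/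
def raySector (κ : ℝ) : Set ℂ := {ζ | ζ ≠ 0 ∧ -κ * ‖ζ‖ ≤ ζ.re}

/-- The integral of `h` along the ray `R + r e`, `r > 0`, issuing from `R` in the direction `e`. -/
noncomputable def rayIntegral (e : ℂ) (h : ℂ → ℂ) (R : ℝ) : ℂ :=
  ∫ r in Ioi (0 : ℝ), h (R + r * e) * e

/-- A unit vector pointing into the open left half-plane, off the real axis; `κ` is minus its
real part. -/
structure IsLeftDirection (κ : ℝ) (e : ℂ) : Prop where
  pos : 0 < κ
  norm : ‖e‖ = 1
  re : e.re = -κ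
  im : e.im ≠ 0

/-- `q` has derivative `q'` on the sector, and `q = O(|ζ|^(-a))`, `q' = O(|ζ|^(-a-1))` there, both with
the explicit constant `C`. -/
structure SectorDecay (κ a C : ℝ) (q q' : ℂ → ℂ) : Prop where
  hasDeriv : ∀ ζ ∈ raySector κ, HasDerivAt q (q' ζ) ζ
  cont : ContinuousOn q' (raySector κ)
  bound : ∀ ζ ∈ raySector κ, ‖q ζ‖ ≤ C * ‖ζ‖ ^ (-a)
  bound' : ∀ ζ ∈ raySector κ, ‖q' ζ‖ ≤ C * ‖ζ‖ ^ (-a - 1)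

namespace IsLeftDirection

variable {κ : ℝ} {e : ℂ}

lemma conj (he : IsLeftDirection κ e) : IsLeftDirection κ (starRingEnd ℂ e) :=
  ⟨he.pos, by simpa using he.norm, by simpa using he.re, by simpa using he.im⟩

lemma sq (he : IsLeftDirection κ e) : κ ^ 2 + e.im ^ 2 = 1 := by
  have h := Complex.sq_norm e
  rw [he.norm, Complex.normSq_apply, he.re] at h
  nlinarith

lemma norm_sq (he : IsLeftDirection κ e) (R r : ℝ) :
    ‖(R + r * e : ℂ)‖ ^ 2 = R ^ 2 - 2 * κ * R * r + r ^ 2 := by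
  rw [Complex.sq_norm, Complex.normSq_apply]
  simp only [Complex.add_re, Complex.ofReal_re, Complex.mul_re, Complex.ofReal_im, zero_mul,
    sub_zero, Complex.add_im, Complex.mul_im, zero_add, he.re]
  linear_combination r ^ 2 * he.sq

lemma le_norm_left (he : IsLeftDirection κ e) (R r : ℝ) : |e.im| * R ≤ ‖(R + r * e : ℂ)‖ := by
  refine (abs_le_of_sq_le_sq' ?_ (norm_nonneg _)).2
  rw [he.norm_sq, mul_pow, sq_abs]
  nlinarith [sq_nonneg (r - κ * R), he.sq]

lemma le_norm_right (he : IsLeftDirection κ e) (R r : ℝ) : |e.im| * r ≤ ‖(R + r * e : ℂ)‖ := by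
  refine (abs_le_of_sq_le_sq' ?_ (norm_nonneg _)).2
  rw [he.norm_sq, mul_pow, sq_abs]
  nlinarith [sq_nonneg (R - κ * r), he.sq]

lemma abs_im_pos (he : IsLeftDirection κ e) : 0 < |e.im| := abs_pos.2 he.im

lemma kappa_lt_one (he : IsLeftDirection κ e) : κ < 1 := by
  have := he.sq
  have := he.abs_im_pos
  have := sq_abs e.im
  nlinarith [he.pos]

lemma norm_pos (he : IsLeftDirection κ e) {R r : ℝ} (h : 0 < R ∨ 0 < r) :
    0 < ‖(R + r * e : ℂ)‖ := by
  rcases h with h | h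
  · exact (mul_pos he.abs_im_pos h).trans_le (he.le_norm_left R r)
  · exact (mul_pos he.abs_im_pos h).trans_le (he.le_norm_right R r)

lemma mem_raySector (he : IsLeftDirection κ e) {R r : ℝ} (hR : 0 ≤ R) (hr : 0 ≤ r)
    (h : 0 < R ∨ 0 < r) : (R + r * e : ℂ) ∈ raySector κ := by
  refine ⟨norm_pos_iff.1 (he.norm_pos h), ?_⟩
  have h1 : r - R ≤ ‖(R + r * e : ℂ)‖ := by
    refine (abs_le_of_sq_le_sq' ?_ (norm_nonneg _)).2
    rw [he.norm_sq]
    nlinarith [mul_nonneg hR hr, he.kappa_lt_one]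
  simp only [Complex.add_re, Complex.ofReal_re, Complex.mul_re, Complex.ofReal_im, zero_mul,
    sub_zero, he.re]
  nlinarith [he.pos, he.kappa_lt_one]

lemma norm_exp (he : IsLeftDirection κ e) (R r : ℝ) :
    ‖Complex.exp (R + r * e)‖ = Real.exp R * Real.exp (-κ * r) := by
  rw [Complex.norm_exp, ← Real.exp_add]
  simp [he.re]
  ring

end IsLeftDirection

lemma raySector_subset_slitPlane {κ : ℝ} (hκ : κ < 1) {ζ : ℂ} (hζ : ζ ∈ raySector κ) :
    ζ ∈ Complex.slitPlane := by
  rw [Complex.mem_slitPlane_iff]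
  by_contra! h
  have h1 : ζ = (ζ.re : ℂ) := Complex.ext (by simp) (by simpa using h.2)
  have h2 : ‖ζ‖ = -ζ.re := by
    conv_lhs => rw [h1]
    rw [Complex.norm_real, Real.norm_of_nonpos h.1]
  have h3 := norm_pos_iff.2 hζ.1
  nlinarith [hζ.2]

section Vertex

variable {κ a C : ℝ} {e : ℂ} {q q' : ℂ → ℂ}

lemma SectorDecay.const_nonneg (hq : SectorDecay κ a C q q') (he : IsLeftDirection κ e) :
    0 ≤ C := by
  have h := (norm_nonneg _).trans (hq.bound _ (he.mem_raySector zero_le_one le_rfl (by simp)))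
  exact nonneg_of_mul_nonneg_left h (Real.rpow_pos_of_pos (he.norm_pos (by simp)) _)

lemma SectorDecay.continuousOn (hq : SectorDecay κ a C q q') : ContinuousOn q (raySector κ) :=
  fun ζ hζ => (hq.hasDeriv ζ hζ).continuousAt.continuousWithinAt

lemma aestronglyMeasurable_ray (he : IsLeftDirection κ e) {h : ℂ → ℂ}
    (hh : ContinuousOn h (raySector κ)) {R : ℝ} (hR : 0 ≤ R) :
    AEStronglyMeasurable (fun r : ℝ => h (R + r * e)) (volume.restrict (Ioi 0)) :=
  (hh.comp (by fun_prop) fun r (hr : 0 < r) =>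
    he.mem_raySector hR hr.le (Or.inr hr)).aestronglyMeasurable measurableSet_Ioi

/-- On a ray whose vertex is at least `ρ`, both `q` and `q + q'` are bounded. -/
lemma SectorDecay.bound_ray (hq : SectorDecay κ a C q q') (he : IsLeftDirection κ e)
    (ha : 0 < a) {ρ R r : ℝ} (hρ : 0 < ρ) (hR : ρ ≤ R) (hr : 0 ≤ r) :
    ‖q (R + r * e)‖ ≤ C * (|e.im| * ρ) ^ (-a) ∧
      ‖q (R + r * e) + q' (R + r * e)‖ ≤
        C * (|e.im| * ρ) ^ (-a) + C * (|e.im| * ρ) ^ (-a - 1) := by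
  have hm := he.mem_raySector (hρ.le.trans hR) hr (Or.inl (hρ.trans_le hR))
  have hl : |e.im| * ρ ≤ ‖(R + r * e : ℂ)‖ :=
    (mul_le_mul_of_nonneg_left hR (abs_nonneg _)).trans (he.le_norm_left R r)
  have hp := mul_pos he.abs_im_pos hρ
  have hC := hq.const_nonneg he
  have h1 : ‖q (R + r * e)‖ ≤ C * (|e.im| * ρ) ^ (-a) := (hq.bound _ hm).trans
    (mul_le_mul_of_nonneg_left (Real.rpow_le_rpow_of_nonpos hp hl (by linarith)) hC)
  have h2 : ‖q' (R + r * e)‖ ≤ C * (|e.im| * ρ) ^ (-a - 1) := (hq.bound' _ hm).trans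
    (mul_le_mul_of_nonneg_left (Real.rpow_le_rpow_of_nonpos hp hl (by linarith)) hC)
  exact ⟨h1, (norm_add_le _ _).trans (add_le_add h1 h2)⟩

lemma integrable_exp_ray (he : IsLeftDirection κ e) (K : ℝ) :
    Integrable (fun r : ℝ => K * Real.exp (-κ * r)) (volume.restrict (Ioi 0)) :=
  (exp_neg_integrableOn_Ioi 0 he.pos).const_mul K

/-- `exp` times a bounded continuous function is integrable along the rays. -/
lemma integrable_ray (he : IsLeftDirection κ e) {h : ℂ → ℂ}
    (hh : ContinuousOn h (raySector κ)) {R K : ℝ} (hR : 0 ≤ R)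
    (hK : ∀ r : ℝ, 0 < r → ‖h (R + r * e)‖ ≤ K) :
    Integrable (fun r : ℝ => Complex.exp (R + r * e) * h (R + r * e) * e)
      (volume.restrict (Ioi 0)) := by
  refine (integrable_exp_ray he (Real.exp R * K)).mono'
    ((aestronglyMeasurable_ray he (h := fun ζ => Complex.exp ζ * h ζ)
      (by fun_prop) hR).mul_const e) ?_
  refine ae_restrict_of_forall_mem measurableSet_Ioi fun r hr => ?_
  rw [norm_mul, norm_mul, he.norm, he.norm_exp, mul_one]
  have := hK r hr
  calc _ ≤ Real.exp R * Real.exp (-κ * r) * K := by gcongr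
    _ = _ := by ring

lemma hasDerivAt_exp_mul (hq : SectorDecay κ a C q q') {ζ : ℂ} (hζ : ζ ∈ raySector κ) :
    HasDerivAt (fun ζ => Complex.exp ζ * q ζ) (Complex.exp ζ * (q ζ + q' ζ)) ζ := by
  simpa only [mul_add] using! (Complex.hasDerivAt_exp ζ).mul (hq.hasDeriv ζ hζ)

/-- Integrating a derivative along a ray leaves only the vertex term, which does not depend on the
direction of the ray. -/
lemma rayIntegral_deriv (hq : SectorDecay κ a C q q') (he : IsLeftDirection κ e) (ha : 0 < a)
    {R : ℝ} (hR : 0 < R) :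
    rayIntegral e (fun ζ => Complex.exp ζ * (q ζ + q' ζ)) R = -(Complex.exp R * q R) := by
  have hd : ∀ r ∈ Ici (0 : ℝ), HasDerivAt
      (fun r : ℝ => Complex.exp (R + r * e) * q (R + r * e))
      (Complex.exp (R + r * e) * (q (R + r * e) + q' (R + r * e)) * e) r := by
    intro r hr
    have h1 : HasDerivAt (fun r : ℝ => (R + r * e : ℂ)) e r := by
      simpa using ((Complex.ofRealCLM.hasDerivAt (x := r)).mul_const e).const_add (R : ℂ)
    exact (hasDerivAt_exp_mul hq (he.mem_raySector hR.le hr (Or.inl hR))).comp r h1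
  have h := integral_Ioi_of_hasDerivAt_of_tendsto (a := (0 : ℝ)) (m := (0 : ℂ))
    (hd 0 self_mem_Ici).continuousAt.continuousWithinAt
    (fun r hr => hd r (Ioi_subset_Ici_self hr)) ?_ ?_
  · rw [rayIntegral, h]; simp
  · exact integrable_ray he (hq.continuousOn.add hq.cont) hR.le
      fun r hr => (hq.bound_ray he ha hR le_rfl hr.le).2
  · refine squeeze_zero_norm' (a := fun r => Real.exp R * Real.exp (-κ * r) *
      (C * (|e.im| * R) ^ (-a))) ?_ ?_
    · filter_upwards [eventually_ge_atTop 0] with r hr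
      rw [norm_mul, he.norm_exp]
      have := (hq.bound_ray he ha hR le_rfl hr).1
      gcongr
    · have : Tendsto (fun r => Real.exp (-κ * r)) atTop (𝓝 0) :=
        Real.tendsto_exp_atBot.comp (tendsto_id.const_mul_atTop_of_neg (by linarith [he.pos]))
      simpa using (this.const_mul (Real.exp R)).mul_const (C * (|e.im| * R) ^ (-a))

lemma hasDerivAt_rayIntegral (hq : SectorDecay κ a C q q') (he : IsLeftDirection κ e)
    (ha : 0 < a) {R : ℝ} (hR : 0 < R) :
    HasDerivAt (rayIntegral e fun ζ => Complex.exp ζ * q ζ) (-(Complex.exp R * q R)) R := by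
  rw [← rayIntegral_deriv hq he ha hR]
  set K := C * (|e.im| * (R / 2)) ^ (-a) + C * (|e.im| * (R / 2)) ^ (-a - 1) with hKdef
  refine (hasDerivAt_integral_of_dominated_loc_of_deriv_le (μ := volume.restrict (Ioi (0 : ℝ)))
    (F := fun x r : ℝ => Complex.exp (x + r * e) * q (x + r * e) * e)
    (F' := fun x r : ℝ => Complex.exp (x + r * e) * (q (x + r * e) + q' (x + r * e)) * e)
    (s := Ioo (R / 2) (2 * R)) (bound := fun r => (Real.exp (2 * R) * K) * Real.exp (-κ * r))
    (Ioo_mem_nhds (half_lt_self hR) (lt_two_mul_self hR)) ?_ ?_ ?_ ?_ (integrable_exp_ray he _) ?_).2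
  · filter_upwards [lt_mem_nhds hR] with x hx
    exact (aestronglyMeasurable_ray he (h := fun ζ => Complex.exp ζ * q ζ)
      (Complex.continuous_exp.continuousOn.mul hq.continuousOn) hx.le).mul_const e
  · exact integrable_ray he hq.continuousOn hR.le
      fun r hr => (hq.bound_ray he ha hR le_rfl hr.le).1
  · exact (integrable_ray he (hq.continuousOn.add hq.cont) hR.le
      fun r hr => (hq.bound_ray he ha hR le_rfl hr.le).2).aestronglyMeasurable
  · refine ae_restrict_of_forall_mem measurableSet_Ioi fun r (hr : 0 < r) x hx => ?_
    rw [norm_mul, norm_mul, he.norm, he.norm_exp, mul_one]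
    have h1 := (hq.bound_ray he ha (half_pos hR) hx.1.le hr.le).2
    have h2 : Real.exp x ≤ Real.exp (2 * R) := Real.exp_le_exp.2 hx.2.le
    calc _ ≤ Real.exp (2 * R) * Real.exp (-κ * r) * K := by gcongr
      _ = _ := by ring
  · refine ae_restrict_of_forall_mem measurableSet_Ioi fun r (hr : 0 < r) x hx => ?_
    have hx0 : 0 < x := (half_pos hR).trans hx.1
    have h1 : HasDerivAt (fun x : ℝ => (x + r * e : ℂ)) 1 x := by
      simpa using (Complex.ofRealCLM.hasDerivAt (x := x)).add_const (r * e : ℂ)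
    have h2 := (hasDerivAt_exp_mul hq (he.mem_raySector hx0.le hr.le (Or.inl hx0))).comp x h1
    rw [mul_one] at h2
    exact h2.mul_const e

/-- `|ζ|^(-a)` with `a < 1` is integrable against `exp` along a ray from the origin. -/
lemma integrable_rpow_ray (he : IsLeftDirection κ e) (ha1 : a < 1) (K : ℝ) :
    Integrable (fun r : ℝ => K * (r ^ (-a) * Real.exp (-κ * r))) (volume.restrict (Ioi 0)) := by
  have := integrableOn_rpow_mul_exp_neg_mul_rpow (s := -a) (p := 1) (by linarith) one_pos he.pos
  simp only [Real.rpow_one] at this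
  exact this.const_mul K

lemma tendsto_rayIntegral_zero (hq : SectorDecay κ a C q q') (he : IsLeftDirection κ e)
    (ha : 0 < a) (ha1 : a < 1) :
    Tendsto (rayIntegral e fun ζ => Complex.exp ζ * q ζ) (𝓝[>] 0)
      (𝓝 (rayIntegral e (fun ζ => Complex.exp ζ * q ζ) 0)) := by
  have hC := hq.const_nonneg he
  have hcont : ContinuousOn (fun ζ => Complex.exp ζ * q ζ) (raySector κ) :=
    Complex.continuous_exp.continuousOn.mul hq.continuousOn
  refine tendsto_integral_filter_of_dominated_convergence
    (fun r => (Real.exp 1 * (C * |e.im| ^ (-a))) * (r ^ (-a) * Real.exp (-κ * r))) ?_ ?_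
    (integrable_rpow_ray he ha1 _) ?_
  · filter_upwards [self_mem_nhdsWithin] with x hx
    exact (aestronglyMeasurable_ray he hcont (le_of_lt hx)).mul_const e
  · have h1 : ∀ᶠ x : ℝ in 𝓝[>] 0, x < 1 :=
      mem_nhdsWithin_of_mem_nhds (Iio_mem_nhds one_pos)
    filter_upwards [self_mem_nhdsWithin, h1] with x (hx : 0 < x) hx1
    refine ae_restrict_of_forall_mem measurableSet_Ioi fun r (hr : 0 < r) => ?_
    rw [norm_mul, norm_mul, he.norm, he.norm_exp, mul_one]
    have h2 : ‖q (x + r * e)‖ ≤ C * (|e.im| ^ (-a) * r ^ (-a)) := by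
      refine (hq.bound _ (he.mem_raySector hx.le hr.le (Or.inr hr))).trans ?_
      rw [← Real.mul_rpow (abs_nonneg _) hr.le]
      exact mul_le_mul_of_nonneg_left (Real.rpow_le_rpow_of_nonpos
        (mul_pos he.abs_im_pos hr) (he.le_norm_right x r) (by linarith)) hC
    have h3 : Real.exp x ≤ Real.exp 1 := Real.exp_le_exp.2 hx1.le
    calc _ ≤ Real.exp 1 * Real.exp (-κ * r) * (C * (|e.im| ^ (-a) * r ^ (-a))) := by gcongr
      _ = _ := by ring
  · refine ae_restrict_of_forall_mem measurableSet_Ioi fun r (hr : 0 < r) => ?_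
    have hm := he.mem_raySector le_rfl hr.le (Or.inr hr)
    have h1 : ContinuousAt (fun ζ => Complex.exp ζ * q ζ) ((0 : ℝ) + r * e) :=
      (hasDerivAt_exp_mul hq hm).continuousAt
    have h2 : Tendsto (fun x : ℝ => (x + r * e : ℂ)) (𝓝[>] 0) (𝓝 ((0 : ℝ) + r * e)) :=
      tendsto_nhdsWithin_of_tendsto_nhds
        ((Complex.continuous_ofReal.add continuous_const).tendsto 0)
    exact (h1.tendsto.comp h2).mul_const e

end Vertex

/-- The integral of `h` over the contour running in from infinity along the ray `R + r ē` and out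
along the ray `R + r e`. -/
noncomputable def hankelIntegral (e : ℂ) (h : ℂ → ℂ) (R : ℝ) : ℂ :=
  rayIntegral e h R - rayIntegral (starRingEnd ℂ e) h R

section Hankel

variable {κ a C : ℝ} {e : ℂ} {q q' : ℂ → ℂ}

lemma hankelIntegral_deriv (hq : SectorDecay κ a C q q') (he : IsLeftDirection κ e) (ha : 0 < a)
    {R : ℝ} (hR : 0 < R) :
    hankelIntegral e (fun ζ => Complex.exp ζ * (q ζ + q' ζ)) R = 0 := by
  rw [hankelIntegral, rayIntegral_deriv hq he ha hR, rayIntegral_deriv hq he.conj ha hR, sub_self]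

/-- The vertex of the contour may be pushed to the origin: the derivative of the contour integral
in the vertex is the difference of the two vertex terms, which cancel. -/
lemma hankelIntegral_eq_zero_vertex (hq : SectorDecay κ a C q q') (he : IsLeftDirection κ e)
    (ha : 0 < a) (ha1 : a < 1) {R : ℝ} (hR : 0 < R) :
    hankelIntegral e (fun ζ => Complex.exp ζ * q ζ) R =
      hankelIntegral e (fun ζ => Complex.exp ζ * q ζ) 0 := by
  set H := hankelIntegral e (fun ζ => Complex.exp ζ * q ζ) with hH
  have hd : ∀ x ∈ Ioi (0 : ℝ), HasDerivAt H 0 x := fun x hx => by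
    simpa using! (hasDerivAt_rayIntegral hq he ha hx).sub (hasDerivAt_rayIntegral hq he.conj ha hx)
  have hconst : ∀ x ∈ Ioi (0 : ℝ), H x = H R := fun x hx =>
    isOpen_Ioi.is_const_of_deriv_eq_zero isPreconnected_Ioi
      (fun y hy => (hd y hy).differentiableAt.differentiableWithinAt)
      (fun y hy => (hd y hy).deriv) hx hR
  have h1 : Tendsto H (𝓝[>] 0) (𝓝 (H 0)) :=
    (tendsto_rayIntegral_zero hq he ha ha1).sub (tendsto_rayIntegral_zero hq he.conj ha ha1)
  have h2 : Tendsto H (𝓝[>] 0) (𝓝 (H R)) :=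
    tendsto_const_nhds.congr' (by
      filter_upwards [self_mem_nhdsWithin] with x hx using (hconst x hx).symm)
  exact tendsto_nhds_unique h2 h1

end Hankel

/-! ### Euler's integral with a complex rate -/

section Gamma

variable {a : ℝ} {w : ℂ}

lemma integrable_rpow_mul_cexp {s : ℝ} (hs : -1 < s) (hw : 0 < w.re) :
    Integrable (fun r : ℝ => ((r ^ s : ℝ) : ℂ) * Complex.exp (-(r * w)))
      (volume.restrict (Ioi 0)) := by
  have h := integrableOn_rpow_mul_exp_neg_mul_rpow (s := s) (p := 1) hs one_pos hw
  simp only [Real.rpow_one] at h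
  refine Integrable.mono' h ?_ ?_
  · exact (by fun_prop : Measurable
      (fun r : ℝ => ((r ^ s : ℝ) : ℂ) * Complex.exp (-(r * w)))).aestronglyMeasurable
  · refine ae_restrict_of_forall_mem measurableSet_Ioi fun r (hr : 0 < r) => ?_
    rw [norm_mul, Complex.norm_real, Real.norm_of_nonneg (Real.rpow_nonneg hr.le _),
      Complex.norm_exp]
    simp [mul_comm]

lemma integral_rpow_mul_cexp_parts (ha : 0 < a) (hw : 0 < w.re) :
    w * ∫ r in Ioi (0 : ℝ), ((r ^ a : ℝ) : ℂ) * Complex.exp (-(r * w)) =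
      a * ∫ r in Ioi (0 : ℝ), ((r ^ (a - 1) : ℝ) : ℂ) * Complex.exp (-(r * w)) := by
  have hi1 := integrable_rpow_mul_cexp (s := a - 1) (by linarith) hw
  have hi2 := integrable_rpow_mul_cexp (s := a) (by linarith) hw
  have hexp : ∀ r : ℝ, HasDerivAt (fun r : ℝ => Complex.exp (-(r * w)))
      (Complex.exp (-(r * w)) * -w) r := fun r => by
    have h1 : HasDerivAt (fun r : ℝ => (-(r * w) : ℂ)) (-w) r := by
      simpa using! ((Complex.ofRealCLM.hasDerivAt (x := r)).mul_const w).neg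
    exact h1.cexp
  have h := integral_Ioi_of_hasDerivAt_of_tendsto (a := (0 : ℝ)) (m := (0 : ℂ))
    (f := fun r : ℝ => ((r ^ a : ℝ) : ℂ) * Complex.exp (-(r * w)))
    (f' := fun r : ℝ => a * (((r ^ (a - 1) : ℝ) : ℂ) * Complex.exp (-(r * w))) -
      w * (((r ^ a : ℝ) : ℂ) * Complex.exp (-(r * w)))) ?_ ?_ ?_ ?_
  · rw [integral_sub (hi1.const_mul _) (hi2.const_mul _), integral_const_mul,
      integral_const_mul] at h
    simp only [Real.zero_rpow ha.ne', Complex.ofReal_zero] at h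
    linear_combination -h
  · refine Continuous.continuousWithinAt ?_
    exact (Complex.continuous_ofReal.comp (Real.continuous_rpow_const ha.le)).mul (by fun_prop)
  · intro r (hr : 0 < r)
    have h1 := (Real.hasDerivAt_rpow_const (x := r) (p := a) (Or.inl hr.ne')).ofReal_comp
    convert! h1.mul (hexp r) using 1
    push_cast
    ring
  · exact (hi1.const_mul _).sub (hi2.const_mul _)
  · rw [tendsto_zero_iff_norm_tendsto_zero]
    refine (tendsto_rpow_mul_exp_neg_mul_atTop_nhds_zero a w.re hw).congr' ?_
    filter_upwards [eventually_ge_atTop 0] with r hr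
    rw [norm_mul, Complex.norm_real, Real.norm_of_nonneg (Real.rpow_nonneg hr _),
      Complex.norm_exp]
    simp [mul_comm]

/-- Euler's integral with a complex rate: `w ^ a * ∫ r^(a-1) exp (-r w) dr` has zero derivative on
the right half-plane and equals `Γ(a)` at `w = 1`. -/
lemma cpow_mul_integral_rpow_mul_cexp (ha : 0 < a) (hw : 0 < w.re) :
    w ^ (a : ℂ) * ∫ r in Ioi (0 : ℝ), ((r ^ (a - 1) : ℝ) : ℂ) * Complex.exp (-(r * w)) =
      (Real.Gamma a : ℂ) := by
  set F : ℂ → ℂ := fun w => ∫ r in Ioi (0 : ℝ), ((r ^ (a - 1) : ℝ) : ℂ) * Complex.exp (-(r * w))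
    with hF
  have hdF : ∀ w : ℂ, 0 < w.re → HasDerivAt F
      (-∫ r in Ioi (0 : ℝ), ((r ^ a : ℝ) : ℂ) * Complex.exp (-(r * w))) w := by
    intro w hw
    rw [← integral_neg]
    have hb := integrableOn_rpow_mul_exp_neg_mul_rpow (s := a) (p := 1) (b := w.re / 2)
      (by linarith) one_pos (half_pos hw)
    simp only [Real.rpow_one] at hb
    have hopen : IsOpen {z : ℂ | w.re / 2 < z.re} := isOpen_lt continuous_const Complex.continuous_re
    refine (hasDerivAt_integral_of_dominated_loc_of_deriv_le (μ := volume.restrict (Ioi (0 : ℝ)))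
      (F := fun (z : ℂ) (r : ℝ) => ((r ^ (a - 1) : ℝ) : ℂ) * Complex.exp (-(r * z)))
      (F' := fun (z : ℂ) (r : ℝ) => -(((r ^ a : ℝ) : ℂ) * Complex.exp (-(r * z))))
      (s := {z : ℂ | w.re / 2 < z.re}) (hopen.mem_nhds (half_lt_self hw)) ?_ ?_ ?_ ?_ hb ?_).2
    · exact Eventually.of_forall fun z => (by fun_prop : Measurable
        (fun r : ℝ => ((r ^ (a - 1) : ℝ) : ℂ) * Complex.exp (-(r * z)))).aestronglyMeasurable
    · exact integrable_rpow_mul_cexp (by linarith) hw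
    · exact (integrable_rpow_mul_cexp (by linarith) hw).neg.aestronglyMeasurable
    · refine ae_restrict_of_forall_mem measurableSet_Ioi fun r (hr : 0 < r) z (hz : _ < z.re) => ?_
      rw [norm_neg, norm_mul, Complex.norm_real, Real.norm_of_nonneg (Real.rpow_nonneg hr.le _),
        Complex.norm_exp]
      refine mul_le_mul_of_nonneg_left (Real.exp_le_exp.2 ?_) (Real.rpow_nonneg hr.le _)
      simp only [Complex.neg_re, Complex.mul_re, Complex.ofReal_re, Complex.ofReal_im, zero_mul,
        sub_zero]
      nlinarith
    · refine ae_restrict_of_forall_mem measurableSet_Ioi fun r (hr : 0 < r) z _ => ?_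
      have h1 : HasDerivAt (fun z : ℂ => -(r * z)) (-(r : ℂ)) z := by
        simpa using! ((hasDerivAt_id z).const_mul (r : ℂ)).neg
      convert! h1.cexp.const_mul ((r ^ (a - 1) : ℝ) : ℂ) using 1
      rw [Real.rpow_sub_one hr.ne']
      have : (r : ℂ) ≠ 0 := by exact_mod_cast hr.ne'
      push_cast
      field_simp
  have hopen : IsOpen {z : ℂ | 0 < z.re} := isOpen_lt continuous_const Complex.continuous_re
  have hd : ∀ z ∈ {z : ℂ | 0 < z.re}, HasDerivAt (fun z => z ^ (a : ℂ) * F z) 0 z := by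
    intro z (hz : 0 < z.re)
    have hz0 : z ≠ 0 := fun h => by simp [h] at hz
    convert! (((hasDerivAt_id z).cpow_const (c := (a : ℂ)) (Or.inl hz))).mul (hdF z hz) using 1
    have h := integral_rpow_mul_cexp_parts ha hz
    change _ = a * F z at h
    generalize (∫ r in Ioi (0 : ℝ), ((r ^ a : ℝ) : ℂ) * Complex.exp (-(r * z))) = G at h ⊢
    simp only [id]
    rw [Complex.cpow_sub _ _ hz0, Complex.cpow_one]
    field_simp
    linear_combination z ^ (a : ℂ) * h
  have hone : (1 : ℂ) ∈ {z : ℂ | 0 < z.re} := by simp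
  have hconv : Convex ℝ {z : ℂ | 0 < z.re} := convex_halfSpace_re_gt 0
  have h := hopen.is_const_of_deriv_eq_zero hconv.isPreconnected
    (fun y hy => (hd y hy).differentiableAt.differentiableWithinAt)
    (fun y hy => (hd y hy).deriv) hw hone
  rw [h, Complex.one_cpow, one_mul, hF, Real.Gamma_eq_integral ha, ← integral_complex_ofReal]
  refine setIntegral_congr_fun measurableSet_Ioi fun r hr => ?_
  simp [mul_comm]

end Gamma

/-! ### Hankel's formula for the reciprocal Gamma function -/

section HankelGamma

variable {κ : ℝ} {e : ℂ}

lemma sectorDecay_cpow {b : ℝ} (hκ : κ < 1) (hb : 0 < b) :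
    SectorDecay κ b (1 + b) (fun ζ => ζ ^ (-b : ℂ)) (fun ζ => -b * ζ ^ (-b - 1 : ℂ)) where
  hasDeriv ζ hζ := by
    simpa using (hasDerivAt_id ζ).cpow_const (c := (-b : ℂ)) (raySector_subset_slitPlane hκ hζ)
  cont := continuousOn_const.mul
    (continuousOn_id.cpow_const fun ζ hζ => raySector_subset_slitPlane hκ hζ)
  bound ζ hζ := by
    have h : ‖ζ ^ (-b : ℂ)‖ = ‖ζ‖ ^ (-b) := by exact_mod_cast Complex.norm_cpow_real ζ (-b)
    rw [h]
    nlinarith [Real.rpow_nonneg (norm_nonneg ζ) (-b)]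
  bound' ζ hζ := by
    have h : ‖ζ ^ (-b - 1 : ℂ)‖ = ‖ζ‖ ^ (-b - 1) := by
      exact_mod_cast Complex.norm_cpow_real ζ (-b - 1)
    rw [norm_mul, h, norm_neg, Complex.norm_real, Real.norm_of_nonneg hb.le]
    nlinarith [Real.rpow_nonneg (norm_nonneg ζ) (-b - 1)]

/-- The ray integral from the origin. With `e = exp (i ϑ)` and `-e = exp (i (ϑ - π τ))`, `τ = ±1`,
in principal arguments, the dependence on `ϑ` cancels. -/
lemma rayIntegral_zero_cpow {ϑ τ b : ℝ} (h1 : -Real.pi < ϑ) (h2 : ϑ ≤ Real.pi)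
    (h3 : -Real.pi < ϑ - Real.pi * τ) (h4 : ϑ - Real.pi * τ ≤ Real.pi)
    (hτ : Complex.exp (Real.pi * τ * Complex.I) = -1) (hneg : Real.cos ϑ < 0) (hb : b < 1) :
    rayIntegral (Complex.exp (ϑ * Complex.I)) (fun ζ => Complex.exp ζ * ζ ^ (-b : ℂ)) 0 =
      Complex.exp (Real.pi * τ * (1 - b) * Complex.I) * Real.Gamma (1 - b) := by
  set e := Complex.exp (ϑ * Complex.I) with he
  have he0 : e ≠ 0 := Complex.exp_ne_zero _
  have hlog : Complex.log e = ϑ * Complex.I :=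
    Complex.log_exp (by simpa using h1) (by simpa using h2)
  have hne : -e = Complex.exp ((ϑ - Real.pi * τ : ℝ) * Complex.I) := by
    push_cast
    rw [sub_mul, Complex.exp_sub, hτ, div_neg, div_one]
  have hlogn : Complex.log (-e) = (ϑ - Real.pi * τ : ℝ) * Complex.I := by
    rw [hne]
    exact Complex.log_exp (by simpa using h3) (by simpa using h4)
  have hre : 0 < (-e).re := by
    rw [Complex.neg_re, he, Complex.exp_ofReal_mul_I_re]
    linarith
  have hG := cpow_mul_integral_rpow_mul_cexp (a := 1 - b) (by linarith) hre
  have hray : rayIntegral e (fun ζ => Complex.exp ζ * ζ ^ (-b : ℂ)) 0 = e ^ (-b : ℂ) * e *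
      ∫ r in Ioi (0 : ℝ), ((r ^ (1 - b - 1) : ℝ) : ℂ) * Complex.exp (-(r * -e)) := by
    rw [rayIntegral, ← integral_const_mul]
    refine setIntegral_congr_fun measurableSet_Ioi fun r (hr : 0 < r) => ?_
    have hr0 : (r : ℂ) ≠ 0 := by exact_mod_cast hr.ne'
    have h5 : (r * e : ℂ) ^ (-b : ℂ) = ((r ^ (1 - b - 1) : ℝ) : ℂ) * e ^ (-b : ℂ) := by
      rw [Complex.cpow_def_of_ne_zero (mul_ne_zero hr0 he0), Complex.log_ofReal_mul hr he0,
        add_mul, Complex.exp_add, ← Complex.cpow_def_of_ne_zero he0,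
        show (1 - b - 1 : ℝ) = -b by ring, Complex.ofReal_cpow hr.le,
        Complex.cpow_def_of_ne_zero hr0, Complex.ofReal_log hr.le]
      push_cast
      rfl
    simp only [Complex.ofReal_zero, zero_add, h5, mul_neg, neg_neg]
    ring
  rw [hray]
  rw [Complex.cpow_def_of_ne_zero (neg_ne_zero.2 he0), hlogn] at hG
  rw [← hG, Complex.cpow_def_of_ne_zero he0, hlog]
  generalize (∫ r in Ioi (0 : ℝ), ((r ^ (1 - b - 1) : ℝ) : ℂ) * Complex.exp (-(r * -e))) = J
  rw [he, ← Complex.exp_add, ← mul_assoc, ← Complex.exp_add]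
  congr 2
  push_cast
  ring

/-- The direction `exp (iθ)` with `π/2 < θ < π`. -/
lemma isLeftDirection_exp {θ : ℝ} (h1 : Real.pi / 2 < θ) (h2 : θ < Real.pi) :
    IsLeftDirection (-Real.cos θ) (Complex.exp (θ * Complex.I)) where
  pos := neg_pos.2 (Real.cos_neg_of_pi_div_two_lt_of_lt h1 (by linarith [Real.pi_pos]))
  norm := Complex.norm_exp_ofReal_mul_I θ
  re := by rw [Complex.exp_ofReal_mul_I_re, neg_neg]
  im := by
    rw [Complex.exp_ofReal_mul_I_im]
    exact (Real.sin_pos_of_pos_of_lt_pi (by linarith [Real.pi_pos]) h2).ne'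

lemma conj_exp_mul_I (θ : ℝ) : starRingEnd ℂ (Complex.exp (θ * Complex.I)) =
    Complex.exp ((-θ : ℝ) * Complex.I) := by
  rw [← Complex.exp_conj]
  simp

/-- Hankel's formula with the contour pinched at the origin; it is the reflection formula. -/
lemma hankelIntegral_zero_cpow {θ b : ℝ} (h1 : Real.pi / 2 < θ) (h2 : θ < Real.pi)
    (hb0 : 0 < b) (hb : b < 1) :
    hankelIntegral (Complex.exp (θ * Complex.I)) (fun ζ => Complex.exp ζ * ζ ^ (-b : ℂ)) 0 =
      2 * Real.pi * Complex.I / Real.Gamma b := by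
  have hpi := Real.pi_pos
  have hcos := Real.cos_neg_of_pi_div_two_lt_of_lt h1 (by linarith)
  have hA := rayIntegral_zero_cpow (ϑ := θ) (τ := 1) (b := b) (by linarith) h2.le (by linarith)
    (by linarith) (by simp [Complex.exp_pi_mul_I]) hcos hb
  have hB := rayIntegral_zero_cpow (ϑ := -θ) (τ := -1) (b := b) (by linarith) (by linarith)
    (by linarith) (by linarith) (by simp [Complex.exp_neg, Complex.exp_pi_mul_I])
    (by rwa [Real.cos_neg]) hb
  rw [hankelIntegral, conj_exp_mul_I, hA, hB]
  have hG := Real.Gamma_mul_Gamma_one_sub b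
  have hGb := (Real.Gamma_pos_of_pos hb0).ne'
  have hs : Real.sin (Real.pi * b) ≠ 0 :=
    (Real.sin_pos_of_pos_of_lt_pi (by positivity) (by nlinarith)).ne'
  have hG2 : (Real.Gamma (1 - b) : ℂ) * Real.sin (Real.pi * b) = Real.pi / Real.Gamma b := by
    rw [← Complex.ofReal_mul, ← Complex.ofReal_div]
    congr 1
    rw [eq_div_iff hs] at hG
    rw [eq_div_iff hGb]
    linarith
  have hsin : Complex.exp (Real.pi * (1 : ℝ) * (1 - b) * Complex.I) -
      Complex.exp (Real.pi * (-1 : ℝ) * (1 - b) * Complex.I) =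
        2 * Complex.I * Real.sin (Real.pi * b) := by
    have h5 : Real.sin (Real.pi * b) = Real.sin (Real.pi * (1 - b)) := by
      rw [← Real.sin_pi_sub]; ring_nf
    rw [h5, Complex.ofReal_sin, Complex.sin]
    push_cast
    rw [show (Real.pi * 1 * (1 - b) * Complex.I : ℂ) = Real.pi * (1 - b) * Complex.I by ring,
      show (Real.pi * -1 * (1 - b) * Complex.I : ℂ) = -(Real.pi * (1 - b)) * Complex.I by ring]
    linear_combination (Complex.exp (Real.pi * (1 - b) * Complex.I) -
      Complex.exp (-(Real.pi * (1 - b)) * Complex.I)) * Complex.I_sq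
  rw [← sub_mul, hsin]
  linear_combination 2 * Complex.I * hG2

lemma rayIntegral_cpow_recurrence {b R : ℝ} (he : IsLeftDirection κ e) (hb : 0 < b) (hR : 0 < R) :
    rayIntegral e (fun ζ => Complex.exp ζ * (ζ ^ (-b : ℂ) + -b * ζ ^ (-b - 1 : ℂ))) R =
      rayIntegral e (fun ζ => Complex.exp ζ * ζ ^ (-b : ℂ)) R -
        b * rayIntegral e (fun ζ => Complex.exp ζ * ζ ^ (-(b + 1 : ℝ) : ℂ)) R := by
  have hq := sectorDecay_cpow he.kappa_lt_one hb
  have hq1 := sectorDecay_cpow he.kappa_lt_one (b := b + 1) (by linarith)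
  have hi := integrable_ray he hq.continuousOn hR.le
    fun r hr => (hq.bound_ray he hb hR le_rfl hr.le).1
  have hi1 := integrable_ray he hq1.continuousOn hR.le
    fun r hr => (hq1.bound_ray he (by linarith) hR le_rfl hr.le).1
  simp only [rayIntegral]
  rw [← integral_const_mul, ← integral_sub hi (hi1.const_mul _)]
  congr 1
  ext r
  rw [show (-(b + 1 : ℝ) : ℂ) = -b - 1 by push_cast; ring]
  ring

lemma tendsto_rayIntegral_cpow_one {R : ℝ} (he : IsLeftDirection κ e) (hR : 0 < R) :
    Tendsto (fun b : ℝ => rayIntegral e (fun ζ => Complex.exp ζ * ζ ^ (-b : ℂ)) R) (𝓝[<] 1)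
      (𝓝 (rayIntegral e (fun ζ => Complex.exp ζ * ζ ^ (-(1 : ℝ) : ℂ)) R)) := by
  set m := |e.im| * R with hm
  have hm0 : 0 < m := mul_pos he.abs_im_pos hR
  refine tendsto_integral_filter_of_dominated_convergence
    (fun r => (Real.exp R * (1 + m⁻¹)) * Real.exp (-κ * r)) ?_ ?_ (integrable_exp_ray he _) ?_
  · refine Eventually.of_forall fun b => (aestronglyMeasurable_ray he
      (h := fun ζ => Complex.exp ζ * ζ ^ (-b : ℂ)) ?_ hR.le).mul_const e
    exact Complex.continuous_exp.continuousOn.mul (continuousOn_id.cpow_const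
      fun ζ hζ => raySector_subset_slitPlane he.kappa_lt_one hζ)
  · have h1 : ∀ᶠ b : ℝ in 𝓝[<] 1, 0 < b := mem_nhdsWithin_of_mem_nhds (Ioi_mem_nhds one_pos)
    filter_upwards [self_mem_nhdsWithin, h1] with b (hb1 : b < 1) hb0
    refine ae_restrict_of_forall_mem measurableSet_Ioi fun r (hr : 0 < r) => ?_
    have h2 : ‖(R + r * e : ℂ) ^ (-b : ℂ)‖ = ‖(R + r * e : ℂ)‖ ^ (-b) := by
      exact_mod_cast Complex.norm_cpow_real (R + r * e) (-b)
    have h3 : ‖(R + r * e : ℂ)‖ ^ (-b) ≤ 1 + m⁻¹ := by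
      refine (Real.rpow_le_rpow_of_nonpos hm0 (he.le_norm_left R r) (by linarith)).trans ?_
      rcases le_total 1 m with h | h
      · have := Real.rpow_le_one_of_one_le_of_nonpos h (by linarith : -b ≤ 0)
        have := inv_pos.2 hm0
        linarith
      · have := Real.rpow_le_rpow_of_exponent_ge hm0 h (by linarith : -1 ≤ -b)
        rw [Real.rpow_neg_one] at this
        linarith
    rw [norm_mul, norm_mul, he.norm, he.norm_exp, mul_one, h2]
    calc _ ≤ Real.exp R * Real.exp (-κ * r) * (1 + m⁻¹) := by gcongr
      _ = _ := by ring
  · refine ae_restrict_of_forall_mem measurableSet_Ioi fun r (hr : 0 < r) => ?_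
    have h0 := (he.mem_raySector hR.le hr.le (Or.inr hr)).1
    refine Tendsto.mul_const e (Tendsto.const_mul _ ?_)
    refine tendsto_nhdsWithin_of_tendsto_nhds (Continuous.tendsto ?_ 1)
    exact Continuous.const_cpow (by fun_prop) (Or.inl h0)

/-- Hankel's formula for `1/Γ(b)`, `b > 0`. For `b < 1` the vertex moves to the origin, `b = 1` is a
limit, and larger `b` follow by integration by parts. -/
theorem hankelIntegral_cpow {θ b R : ℝ} (h1 : Real.pi / 2 < θ) (h2 : θ < Real.pi)
    (hb : 0 < b) (hR : 0 < R) :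
    hankelIntegral (Complex.exp (θ * Complex.I)) (fun ζ => Complex.exp ζ * ζ ^ (-b : ℂ)) R =
      2 * Real.pi * Complex.I / Real.Gamma b := by
  have he := isLeftDirection_exp h1 h2
  have hlt : ∀ b : ℝ, 0 < b → b < 1 →
      hankelIntegral (Complex.exp (θ * Complex.I)) (fun ζ => Complex.exp ζ * ζ ^ (-b : ℂ)) R =
        2 * Real.pi * Complex.I / Real.Gamma b := fun b hb0 hb1 => by
    rw [hankelIntegral_eq_zero_vertex (sectorDecay_cpow he.kappa_lt_one hb0) he hb0 hb1 hR,
      hankelIntegral_zero_cpow h1 h2 hb0 hb1]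
  have hone :
      hankelIntegral (Complex.exp (θ * Complex.I)) (fun ζ => Complex.exp ζ * ζ ^ (-(1 : ℝ) : ℂ)) R =
        2 * Real.pi * Complex.I / Real.Gamma 1 := by
    have hl := (tendsto_rayIntegral_cpow_one he hR).sub (tendsto_rayIntegral_cpow_one he.conj hR)
    have hΓ : ContinuousAt Real.Gamma 1 :=
      (Real.differentiableAt_Gamma fun m h => by
        have : (0 : ℝ) ≤ m := m.cast_nonneg
        linarith).continuousAt
    have hr : Tendsto (fun b : ℝ => 2 * Real.pi * Complex.I / (Real.Gamma b : ℂ)) (𝓝[<] 1)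
        (𝓝 (2 * Real.pi * Complex.I / Real.Gamma 1)) := by
      refine tendsto_nhdsWithin_of_tendsto_nhds (Tendsto.div tendsto_const_nhds
        ((Complex.continuous_ofReal.tendsto _).comp hΓ.tendsto) ?_)
      simp
    refine tendsto_nhds_unique (hl.congr' ?_) hr
    have h3 : ∀ᶠ b : ℝ in 𝓝[<] 1, 0 < b := mem_nhdsWithin_of_mem_nhds (Ioi_mem_nhds one_pos)
    filter_upwards [self_mem_nhdsWithin, h3] with b hb1 hb0 using hlt b hb0 hb1
  have hall : ∀ n : ℕ, ∀ b : ℝ, 0 < b → b ≤ n + 1 →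
      hankelIntegral (Complex.exp (θ * Complex.I)) (fun ζ => Complex.exp ζ * ζ ^ (-b : ℂ)) R =
        2 * Real.pi * Complex.I / Real.Gamma b := by
    intro n
    induction n with
    | zero =>
      intro b hb0 hb1
      rcases lt_or_eq_of_le (by simpa using hb1 : b ≤ 1) with h | rfl
      · exact hlt b hb0 h
      · exact hone
    | succ n ih =>
      intro b hb0 hb1
      rcases le_or_gt b (n + 1) with h | h
      · exact ih b hb0 h
      · have hn : (0 : ℝ) ≤ n := n.cast_nonneg
        have hc : 0 < b - 1 := by linarith
        have hrec := hankelIntegral_deriv (sectorDecay_cpow he.kappa_lt_one hc) he hc hR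
        have hih := ih (b - 1) hc (by push_cast at hb1; linarith)
        rw [hankelIntegral, rayIntegral_cpow_recurrence he hc hR,
          rayIntegral_cpow_recurrence he.conj hc hR] at hrec
        rw [hankelIntegral] at hih ⊢
        have hG := Real.Gamma_add_one hc.ne'
        rw [sub_add_cancel] at hG hrec
        have hc' : ((b - 1 : ℝ) : ℂ) ≠ 0 := by exact_mod_cast hc.ne'
        have hGc : (Real.Gamma (b - 1) : ℂ) ≠ 0 := by
          exact_mod_cast (Real.Gamma_pos_of_pos hc).ne'
        rw [hG, Complex.ofReal_mul]
        apply mul_left_cancel₀ hc'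
        rw [eq_div_iff hGc] at hih
        field_simp
        field_simp at hrec
        linear_combination hih - Real.Gamma (b - 1) * hrec
  obtain ⟨n, hn⟩ := exists_nat_ge b
  exact hall n b hb (by linarith)

end HankelGamma

/-! ### The Mittag-Leffler function on the negative imaginary axis -/

section MittagLeffler

variable {κ α : ℝ} {e : ℂ}

/-- Summing a geometric series under the integral along a ray whose vertex is far from the
origin. -/
lemma hasSum_rayIntegral (he : IsLeftDirection κ e) (hα : 0 < α) {z : ℂ} {R : ℝ} (hR : 0 < R)
    (hz : 2 * ‖z‖ ≤ (|e.im| * R) ^ α) :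
    HasSum (fun k : ℕ => z ^ k *
        rayIntegral e (fun ζ => Complex.exp ζ * ζ ^ (-(α * k + 1 : ℝ) : ℂ)) R)
      (rayIntegral e (fun ζ => Complex.exp ζ * (ζ ^ (α - 1 : ℂ) / (ζ ^ (α : ℂ) - z))) R) := by
  set m := |e.im| * R with hm
  have hm0 : 0 < m := mul_pos he.abs_im_pos hR
  have hgeom : HasSum (fun k : ℕ => ((1 / 2 : ℝ)) ^ k) 2 := hasSum_geometric_two
  simp only [rayIntegral, ← integral_const_mul]
  refine hasSum_integral_of_dominated_convergence
    (fun k r => (Real.exp R * m⁻¹) * Real.exp (-κ * r) * (1 / 2) ^ k) ?_ ?_ ?_ ?_ ?_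
  · refine fun k => ((aestronglyMeasurable_ray he
      (h := fun ζ => Complex.exp ζ * ζ ^ (-(α * k + 1 : ℝ) : ℂ)) ?_ hR.le).mul_const e).const_mul _
    exact Complex.continuous_exp.continuousOn.mul (continuousOn_id.cpow_const
      fun ζ hζ => raySector_subset_slitPlane he.kappa_lt_one hζ)
  · refine fun k => ae_restrict_of_forall_mem measurableSet_Ioi fun r (hr : 0 < r) => ?_
    have hl : m ≤ ‖(R + r * e : ℂ)‖ := he.le_norm_left R r
    have hl0 := hm0.trans_le hl
    have h2 : ‖(R + r * e : ℂ) ^ (-(α * k + 1 : ℝ) : ℂ)‖ =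
        (‖(R + r * e : ℂ)‖ ^ α)⁻¹ ^ k * ‖(R + r * e : ℂ)‖⁻¹ := by
      have h := Complex.norm_cpow_real (R + r * e) (-(α * k + 1))
      rw [Complex.ofReal_neg] at h
      rw [h, neg_add, Real.rpow_add hl0, Real.rpow_neg_one, Real.rpow_neg hl0.le,
        Real.rpow_mul hl0.le, Real.rpow_natCast, inv_pow]
    rw [norm_mul, norm_mul, norm_mul, he.norm, he.norm_exp, mul_one, h2, norm_pow]
    have h3 : ‖z‖ * (‖(R + r * e : ℂ)‖ ^ α)⁻¹ ≤ 1 / 2 := by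
      have h4 : m ^ α ≤ ‖(R + r * e : ℂ)‖ ^ α := Real.rpow_le_rpow hm0.le hl hα.le
      rw [← div_eq_mul_inv, div_le_iff₀ (Real.rpow_pos_of_pos hl0 α)]
      linarith
    have h5 : ‖(R + r * e : ℂ)‖⁻¹ ≤ m⁻¹ := inv_anti₀ hm0 hl
    calc _ = Real.exp R * ‖(R + r * e : ℂ)‖⁻¹ * Real.exp (-κ * r) *
          (‖z‖ * (‖(R + r * e : ℂ)‖ ^ α)⁻¹) ^ k := by rw [mul_pow]; ring
      _ ≤ _ := by gcongr
  · exact Eventually.of_forall fun r => hgeom.summable.mul_left _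
  · simp only [tsum_mul_left]
    exact (integrable_exp_ray he _).mul_const _
  · refine ae_restrict_of_forall_mem measurableSet_Ioi fun r (hr : 0 < r) => ?_
    have hl : m ≤ ‖(R + r * e : ℂ)‖ := he.le_norm_left R r
    have hl0 := hm0.trans_le hl
    set ζ : ℂ := R + r * e with hζ
    have hζ0 : ζ ≠ 0 := norm_pos_iff.1 hl0
    have hw0 : ζ ^ (α : ℂ) ≠ 0 := by simp [Complex.cpow_eq_zero_iff, hζ0]
    have hn : ‖z / ζ ^ (α : ℂ)‖ < 1 := by
      have h4 : m ^ α ≤ ‖ζ‖ ^ α := Real.rpow_le_rpow hm0.le hl hα.le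
      have h5 := Real.rpow_pos_of_pos hl0 α
      rw [norm_div, Complex.norm_cpow_real, div_lt_one h5]
      linarith [norm_nonneg z]
    have hd : ζ ^ (α : ℂ) - z ≠ 0 := fun h => by
      rw [sub_eq_zero] at h
      rw [h, div_self (h ▸ hw0)] at hn
      simp at hn
    have hs := (hasSum_geometric_of_norm_lt_one hn).mul_left (Complex.exp ζ * ζ⁻¹ * e)
    convert! hs using 1
    · ext k
      have h6 : ζ ^ (-(α * k + 1 : ℝ) : ℂ) = ((ζ ^ (α : ℂ)) ^ k)⁻¹ * ζ⁻¹ := by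
        rw [← Complex.cpow_nat_mul, Complex.cpow_neg]
        push_cast
        rw [Complex.cpow_add _ _ hζ0, Complex.cpow_one, mul_inv, mul_comm (k : ℂ)]
      rw [h6, div_pow]
      ring
    · rw [Complex.cpow_sub _ _ hζ0, Complex.cpow_one]
      have h7 : (1 : ℂ) - z / ζ ^ (α : ℂ) = (ζ ^ (α : ℂ) - z) / ζ ^ (α : ℂ) := by
        field_simp
      rw [h7]
      field_simp

/-- The contour integral of the Mittag-Leffler function over a contour with distant vertex. -/
lemma hasSum_mittagLeffler {θ R : ℝ} {z : ℂ} (h1 : Real.pi / 2 < θ) (h2 : θ < Real.pi)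
    (hα : 0 < α) (hR : 0 < R) (hz : 2 * ‖z‖ ≤ (Real.sin θ * R) ^ α) :
    HasSum (fun k : ℕ => z ^ k / (Real.Gamma (α * k + 1) : ℂ))
      ((2 * Real.pi * Complex.I)⁻¹ * hankelIntegral (Complex.exp (θ * Complex.I))
        (fun ζ => Complex.exp ζ * (ζ ^ (α - 1 : ℂ) / (ζ ^ (α : ℂ) - z))) R) := by
  have he := isLeftDirection_exp h1 h2
  have him : |(Complex.exp (θ * Complex.I)).im| = Real.sin θ := by
    rw [Complex.exp_ofReal_mul_I_im, abs_of_pos]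
    exact Real.sin_pos_of_pos_of_lt_pi (by linarith [Real.pi_pos]) h2
  have hA := hasSum_rayIntegral he hα hR (by rwa [him])
  have hB := hasSum_rayIntegral he.conj hα hR (by rwa [Complex.conj_im, abs_neg, him])
  convert! (hA.sub hB).mul_left (2 * Real.pi * Complex.I)⁻¹ using 1
  ext k
  have h3 := hankelIntegral_cpow h1 h2 (b := α * k + 1) (by positivity) hR
  rw [hankelIntegral] at h3
  rw [← mul_sub, h3]
  have : (Real.pi : ℂ) ≠ 0 := by exact_mod_cast Real.pi_ne_zero
  field_simp

lemma summable_mittagLeffler (hα : 0 < α) (z : ℂ) :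
    Summable fun k : ℕ => z ^ k / (Real.Gamma (α * k + 1) : ℂ) := by
  have hpi := Real.pi_pos
  have hs : 0 < Real.sin (3 * Real.pi / 4) :=
    Real.sin_pos_of_pos_of_lt_pi (by positivity) (by linarith)
  have ht : Tendsto (fun R : ℝ => (Real.sin (3 * Real.pi / 4) * R) ^ α) atTop atTop :=
    (tendsto_rpow_atTop hα).comp (tendsto_id.const_mul_atTop hs)
  obtain ⟨R, hR, hR0⟩ := ((ht.eventually_ge_atTop (2 * ‖z‖)).and (eventually_gt_atTop 0)).exists
  exact (hasSum_mittagLeffler (by linarith) (by linarith) hα hR0 hR).summable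

/-- On the sector, `ζ ^ α` stays in a proper subsector of the right half-plane. -/
lemma le_re_cpow {θ : ℝ} (h1 : 0 ≤ θ) (h2 : θ ≤ Real.pi) (hα : 0 < α) (hαθ : α * θ < Real.pi / 2)
    {ζ : ℂ} (hζ : ζ ∈ raySector (-Real.cos θ)) :
    Real.cos (α * θ) * ‖ζ‖ ^ α ≤ (ζ ^ (α : ℂ)).re := by
  have hn := norm_pos_iff.2 hζ.1
  have harg : |ζ.arg| ≤ θ := by
    by_contra! h
    have h3 := Real.cos_lt_cos_of_nonneg_of_le_pi h1 (Complex.abs_arg_le_pi ζ) h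
    rw [Real.cos_abs] at h3
    have h4 := Complex.norm_mul_cos_arg ζ
    have h5 := hζ.2
    rw [neg_neg] at h5
    nlinarith
  rw [Complex.cpow_ofReal_re, mul_comm]
  refine mul_le_mul_of_nonneg_left ?_ (Real.rpow_nonneg hn.le _)
  rw [← Real.cos_abs (ζ.arg * α), abs_mul, abs_of_pos hα, mul_comm _ α]
  exact Real.cos_le_cos_of_nonneg_of_le_pi (by positivity) (by linarith [Real.pi_pos])
    (mul_le_mul_of_nonneg_left harg hα.le)

/-- The denominator `ζ ^ α + i s` dominates both of its terms on the sector. -/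
lemma norm_le_cpow_add {c s : ℝ} (hc : 0 < c) (hs : 0 < s) {w : ℂ} (hw : c * ‖w‖ ≤ w.re) :
    ‖w‖ ≤ (1 + c⁻¹) * ‖w + Complex.I * s‖ ∧ s ≤ (1 + c⁻¹) * ‖w + Complex.I * s‖ := by
  have h1 : c * ‖w‖ ≤ ‖w + Complex.I * s‖ := by
    refine hw.trans (le_trans (le_of_eq ?_) (Complex.re_le_norm _))
    simp
  have h2 : ‖w‖ ≤ c⁻¹ * ‖w + Complex.I * s‖ := by
    rw [← div_eq_inv_mul, le_div_iff₀ hc, mul_comm]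
    exact h1
  have h3 : s ≤ ‖w + Complex.I * s‖ + ‖w‖ := by
    have : ‖(Complex.I * s : ℂ)‖ = s := by simp [abs_of_pos hs]
    calc s = ‖(w + Complex.I * s) - w‖ := by rw [add_sub_cancel_left, this]
      _ ≤ _ := norm_sub_le _ _
  constructor <;> nlinarith [norm_nonneg (w + Complex.I * s)]

/-- The Mittag-Leffler integrand at `z = -is` satisfies the hypotheses of the vertex shift. -/
lemma sectorDecay_mittagLeffler {c s : ℝ} (hκ : κ < 1) (hα : 0 < α) (hα1 : α < 1) (hc : 0 < c)
    (hs : 0 < s) (hre : ∀ ζ ∈ raySector κ, c * ‖ζ‖ ^ α ≤ (ζ ^ (α : ℂ)).re) :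
    SectorDecay κ (1 - α) ((1 + c⁻¹) ^ 2 * 2 / s)
      (fun ζ => ζ ^ (α - 1 : ℂ) / (ζ ^ (α : ℂ) + Complex.I * s))
      (fun ζ => ((α - 1) * ζ ^ (α - 1 - 1 : ℂ) * (ζ ^ (α : ℂ) + Complex.I * s) -
        ζ ^ (α - 1 : ℂ) * (α * ζ ^ (α - 1 : ℂ))) / (ζ ^ (α : ℂ) + Complex.I * s) ^ 2) := by
  have hbd : ∀ ζ ∈ raySector κ, ‖ζ‖ ^ α ≤ (1 + c⁻¹) * ‖ζ ^ (α : ℂ) + Complex.I * s‖ ∧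
      s ≤ (1 + c⁻¹) * ‖ζ ^ (α : ℂ) + Complex.I * s‖ := fun ζ hζ => by
    have h := norm_le_cpow_add hc hs (w := ζ ^ (α : ℂ))
      (by rw [Complex.norm_cpow_real]; exact hre ζ hζ)
    rwa [Complex.norm_cpow_real] at h
  have hc' : 0 < c⁻¹ := inv_pos.2 hc
  have hne : ∀ ζ ∈ raySector κ, ζ ^ (α : ℂ) + Complex.I * s ≠ 0 := fun ζ hζ h => by
    have := (hbd ζ hζ).2
    rw [h, norm_zero, mul_zero] at this
    linarith
  have hslit : ∀ ζ ∈ raySector κ, ζ ∈ Complex.slitPlane :=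
    fun ζ hζ => raySector_subset_slitPlane hκ hζ
  have hinv : ∀ ζ ∈ raySector κ, ‖ζ ^ (α : ℂ) + Complex.I * s‖⁻¹ ≤ (1 + c⁻¹) / s :=
    fun ζ hζ => by
      have h0 := norm_pos_iff.2 (hne ζ hζ)
      rw [inv_le_iff_one_le_mul₀ h0, div_mul_eq_mul_div, one_le_div hs]
      exact (hbd ζ hζ).2
  refine ⟨fun ζ hζ => ?_, ?_, fun ζ hζ => ?_, fun ζ hζ => ?_⟩
  · have h1 := (hasDerivAt_id ζ).cpow_const (c := (α - 1 : ℂ)) (hslit ζ hζ)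
    have h2 := ((hasDerivAt_id ζ).cpow_const (c := (α : ℂ)) (hslit ζ hζ)).add_const
      (Complex.I * s)
    simpa only [id, mul_one] using! h1.div h2 (hne ζ hζ)
  · have hp : ∀ b : ℂ, ContinuousOn (fun ζ : ℂ => ζ ^ b) (raySector κ) :=
      fun b => continuousOn_id.cpow_const hslit
    refine ContinuousOn.div ?_ ?_ fun ζ hζ => pow_ne_zero 2 (hne ζ hζ)
    · exact ((continuousOn_const.mul (hp _)).mul ((hp _).add continuousOn_const)).sub
        ((hp _).mul (continuousOn_const.mul (hp _)))
    · exact ((hp _).add continuousOn_const).pow 2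
  · have h : ‖ζ ^ (α - 1 : ℂ)‖ = ‖ζ‖ ^ (-(1 - α)) := by
      rw [neg_sub]; exact_mod_cast Complex.norm_cpow_real ζ (α - 1)
    rw [norm_div, h, div_eq_mul_inv, mul_comm]
    refine mul_le_mul_of_nonneg_right ((hinv ζ hζ).trans ?_) (Real.rpow_nonneg (norm_nonneg _) _)
    gcongr
    nlinarith
  · have hn := norm_pos_iff.2 hζ.1
    have h : ‖ζ ^ (α - 1 : ℂ)‖ = ‖ζ‖ ^ (α - 1) := by
      exact_mod_cast Complex.norm_cpow_real ζ (α - 1)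
    have h' : ‖ζ ^ (α - 1 - 1 : ℂ)‖ = ‖ζ‖ ^ (α - 1 - 1) := by
      exact_mod_cast Complex.norm_cpow_real ζ (α - 1 - 1)
    have hc1 : ‖(α - 1 : ℂ)‖ = 1 - α := by
      rw [← Complex.ofReal_one, ← Complex.ofReal_sub, Complex.norm_real, Real.norm_eq_abs,
        abs_sub_comm, abs_of_pos (by linarith)]
    have hc2 : ‖(α : ℂ)‖ = α := by rw [Complex.norm_real, Real.norm_of_nonneg hα.le]
    have hsq : ‖ζ‖ ^ (α - 1) * ‖ζ‖ ^ (α - 1) = ‖ζ‖ ^ (α - 1 - 1) * ‖ζ‖ ^ α := by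
      rw [← Real.rpow_add hn, ← Real.rpow_add hn]; ring_nf
    have h0 := norm_pos_iff.2 (hne ζ hζ)
    have hP := Real.rpow_nonneg hn.le (α - 1 - 1)
    rw [show -(1 - α) - 1 = α - 1 - 1 by ring]
    have hi := hinv ζ hζ
    have hb := (hbd ζ hζ).1
    rw [norm_div, norm_pow]
    set D := ‖ζ ^ (α : ℂ) + Complex.I * s‖ with hD
    set P := ‖ζ‖ ^ (α - 1 - 1) with hPdef
    have hnum : ‖(α - 1) * ζ ^ (α - 1 - 1 : ℂ) * (ζ ^ (α : ℂ) + Complex.I * s) -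
        ζ ^ (α - 1 : ℂ) * (α * ζ ^ (α - 1 : ℂ))‖ ≤ 2 * (1 + c⁻¹) * P * D := by
      refine (norm_sub_le _ _).trans ?_
      rw [norm_mul, norm_mul, norm_mul, norm_mul, h, h', hc1, hc2, ← hD]
      have h3 : ‖ζ‖ ^ (α - 1) * (α * ‖ζ‖ ^ (α - 1)) ≤ (1 + c⁻¹) * P * D := by
        calc _ = α * (P * ‖ζ‖ ^ α) := by rw [← hsq]; ring
          _ ≤ 1 * (P * ((1 + c⁻¹) * D)) := by gcongr
          _ = _ := by ring
      have h4 : (1 - α) * P * D ≤ (1 + c⁻¹) * P * D := by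
        gcongr
        linarith
      linarith
    calc _ ≤ 2 * (1 + c⁻¹) * P * D / D ^ 2 := by gcongr
      _ = 2 * (1 + c⁻¹) * P * D⁻¹ := by field_simp
      _ ≤ 2 * (1 + c⁻¹) * P * ((1 + c⁻¹) / s) := by gcongr
      _ = _ := by ring

lemma tendsto_mul_rayIntegral_mittagLeffler {c : ℝ} (he : IsLeftDirection κ e) (hα : 0 < α)
    (hα1 : α < 1) (hc : 0 < c) (hre : ∀ ζ ∈ raySector κ, c * ‖ζ‖ ^ α ≤ (ζ ^ (α : ℂ)).re) :
    Tendsto (fun s : ℝ => (s : ℂ) * rayIntegral e (fun ζ => Complex.exp ζ *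
        (ζ ^ (α - 1 : ℂ) / (ζ ^ (α : ℂ) + Complex.I * s))) 0) atTop
      (𝓝 (Complex.I⁻¹ * rayIntegral e (fun ζ => Complex.exp ζ * ζ ^ (-(1 - α : ℝ) : ℂ)) 0)) := by
  simp only [rayIntegral, ← integral_const_mul]
  refine tendsto_integral_filter_of_dominated_convergence
    (fun r => (1 + c⁻¹) * (r ^ (-(1 - α)) * Real.exp (-κ * r))) ?_ ?_
    (integrable_rpow_ray he (by linarith) _) ?_
  · filter_upwards [eventually_gt_atTop 0] with s hs
    have hq := sectorDecay_mittagLeffler he.kappa_lt_one hα hα1 hc hs hre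
    exact ((aestronglyMeasurable_ray he
      (Complex.continuous_exp.continuousOn.mul hq.continuousOn) le_rfl).mul_const e).const_mul _
  · filter_upwards [eventually_gt_atTop 0] with s hs
    refine ae_restrict_of_forall_mem measurableSet_Ioi fun r (hr : 0 < r) => ?_
    have hm := he.mem_raySector le_rfl hr.le (Or.inr hr)
    have hn : ‖((0 : ℝ) + r * e : ℂ)‖ = r := by simp [he.norm, abs_of_pos hr]
    have hexp := he.norm_exp 0 r
    rw [Real.exp_zero, one_mul] at hexp
    have h1 := hre _ hm
    rw [← Complex.norm_cpow_real] at h1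
    have h2 := (norm_le_cpow_add hc hs h1).2
    have h3 : ‖((0 : ℝ) + r * e : ℂ) ^ (α - 1 : ℂ)‖ = r ^ (-(1 - α)) := by
      have h := Complex.norm_cpow_real ((0 : ℝ) + r * e) (α - 1)
      rw [hn, Complex.ofReal_sub, Complex.ofReal_one] at h
      rw [h, neg_sub]
    rw [norm_mul, norm_mul, norm_mul, norm_div, he.norm, hexp, h3, mul_one, Complex.norm_real,
      Real.norm_of_nonneg hs.le]
    set D := ‖((0 : ℝ) + r * e : ℂ) ^ (α : ℂ) + Complex.I * s‖
    have hD : 0 < D := by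
      by_contra! h
      have : (1 + c⁻¹) * D ≤ 0 := mul_nonpos_of_nonneg_of_nonpos (by positivity) h
      linarith
    have h4 : s / D ≤ 1 + c⁻¹ := (div_le_iff₀ hD).2 h2
    have h5 : 0 ≤ r ^ (-(1 - α)) := Real.rpow_nonneg hr.le _
    calc _ = s / D * (r ^ (-(1 - α)) * Real.exp (-κ * r)) := by ring
      _ ≤ _ := by gcongr
  · refine ae_restrict_of_forall_mem measurableSet_Ioi fun r (hr : 0 < r) => ?_
    set ζ : ℂ := (0 : ℝ) + r * e
    have h1 : Tendsto (fun s : ℝ => (s : ℂ) / (ζ ^ (α : ℂ) + Complex.I * s)) atTop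
        (𝓝 Complex.I⁻¹) := by
      have h2 : Tendsto (fun s : ℝ => (ζ ^ (α : ℂ) * ((s⁻¹ : ℝ) : ℂ) + Complex.I)⁻¹) atTop
          (𝓝 (ζ ^ (α : ℂ) * ((0 : ℝ) : ℂ) + Complex.I)⁻¹) := by
        refine Tendsto.inv₀ ?_ (by simp)
        exact (((Complex.continuous_ofReal.tendsto _).comp tendsto_inv_atTop_zero).const_mul
          _).add_const _
      rw [Complex.ofReal_zero, mul_zero, zero_add] at h2
      refine h2.congr' ?_
      filter_upwards [eventually_gt_atTop 0] with s hs
      have hs0 : (s : ℂ) ≠ 0 := by exact_mod_cast hs.ne'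
      rw [← inv_div]
      congr 1
      push_cast
      field_simp
    have h6 : (-(1 - α : ℝ) : ℂ) = α - 1 := by push_cast; ring
    rw [h6]
    refine (h1.mul_const (Complex.exp ζ * ζ ^ (α - 1 : ℂ) * e)).congr' ?_ |>.trans (le_of_eq ?_)
    · exact Eventually.of_forall fun s => by ring
    · ring_nf

/-- `E_α(-is) ~ 1 / (i Γ(1-α) s)` as `s → ∞`. -/
theorem tendsto_mul_mittagLeffler (hα : 0 < α) (hα1 : α < 1) :
    Tendsto (fun s : ℝ => (s : ℂ) * mittagLeffler α (-Complex.I * s)) atTop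
      (𝓝 (Complex.I * Real.Gamma (1 - α))⁻¹) := by
  have hpi := Real.pi_pos
  -- `θ` lies beyond `π / 2`, while `α θ` is still below `π / 2`
  set θ := Real.pi / (1 + α) with hθ
  have h1 : Real.pi / 2 < θ := div_lt_div_of_pos_left hpi (by linarith) (by linarith)
  have h2 : θ < Real.pi := div_lt_self hpi (by linarith)
  have hαθ : α * θ < Real.pi / 2 := by
    have : θ * (1 + α) = Real.pi := div_mul_cancel₀ _ (by linarith)
    linarith
  have hθ0 : 0 < θ := by linarith
  have hc : 0 < Real.cos (α * θ) :=
    Real.cos_pos_of_mem_Ioo ⟨by linarith [mul_pos hα hθ0], hαθ⟩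
  have he := isLeftDirection_exp h1 h2
  have hre : ∀ ζ ∈ raySector (-Real.cos θ), Real.cos (α * θ) * ‖ζ‖ ^ α ≤ (ζ ^ (α : ℂ)).re :=
    fun ζ hζ => le_re_cpow hθ0.le h2.le hα hαθ hζ
  have hML : ∀ s : ℝ, 0 < s → mittagLeffler α (-Complex.I * s) = (2 * Real.pi * Complex.I)⁻¹ *
      hankelIntegral (Complex.exp (θ * Complex.I)) (fun ζ => Complex.exp ζ *
        (ζ ^ (α - 1 : ℂ) / (ζ ^ (α : ℂ) + Complex.I * s))) 0 := by
    intro s hs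
    have hsin : 0 < Real.sin θ := Real.sin_pos_of_pos_of_lt_pi hθ0 h2
    have ht : Tendsto (fun R : ℝ => (Real.sin θ * R) ^ α) atTop atTop :=
      (tendsto_rpow_atTop hα).comp (tendsto_id.const_mul_atTop hsin)
    obtain ⟨R, hR, hR0⟩ := ((ht.eventually_ge_atTop (2 * ‖-Complex.I * (s : ℂ)‖)).and
      (eventually_gt_atTop 0)).exists
    have h := (hasSum_mittagLeffler h1 h2 hα hR0 hR).tsum_eq
    simp only [neg_mul, sub_neg_eq_add] at h
    rw [← hankelIntegral_eq_zero_vertex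
      (sectorDecay_mittagLeffler he.kappa_lt_one hα hα1 hc hs hre) he (by linarith) (by linarith)
      hR0, ← h, mittagLeffler]
    simp only [neg_mul]
  have hl := ((tendsto_mul_rayIntegral_mittagLeffler he hα hα1 hc hre).sub
    (tendsto_mul_rayIntegral_mittagLeffler he.conj hα hα1 hc hre)).const_mul
      (2 * Real.pi * Complex.I)⁻¹
  have hH := hankelIntegral_zero_cpow h1 h2 (b := 1 - α) (by linarith) (by linarith)
  rw [hankelIntegral] at hH
  rw [← mul_sub, hH] at hl
  refine (hl.congr' ?_).trans (le_of_eq ?_)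
  · filter_upwards [eventually_gt_atTop 0] with s hs
    rw [hML s hs, hankelIntegral]
    ring
  · congr 1
    have : (Real.pi : ℂ) ≠ 0 := by exact_mod_cast Real.pi_ne_zero
    field_simp

end MittagLeffler

/-! ### The localized kernel -/

section Kernel

variable {n : ℕ} {α β : ℝ} {φ : EuclideanSpace ℝ (Fin n) → ℂ}

lemma measurable_mittagLeffler (hα : 0 < α) :
    Measurable fun s : ℝ => mittagLeffler α (-Complex.I * s) := by
  refine measurable_of_tendsto_metrizable (f := fun N (s : ℝ) =>
    ∑ k ∈ Finset.range N, (-Complex.I * s) ^ k / (Real.Gamma (α * k + 1) : ℂ)) (fun N => ?_) ?_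
  · exact (by fun_prop : Continuous fun s : ℝ =>
      ∑ k ∈ Finset.range N, (-Complex.I * s) ^ k / (Real.Gamma (α * k + 1) : ℂ)).measurable
  · exact tendsto_pi_nhds.2 fun s =>
      (summable_mittagLeffler hα (-Complex.I * s)).hasSum.tendsto_sum_nat

lemma dyadicCutoff_smul (j : ℤ) (η : EuclideanSpace ℝ (Fin n)) :
    dyadicCutoff φ j ((2 : ℝ) ^ j • η) = dyadicCutoff φ 0 η := by
  have h0 : ((2 : ℝ) ^ j) ≠ 0 := by positivity
  have h1 : ((2 : ℝ) ^ (j - 1))⁻¹ * (2 : ℝ) ^ j = ((2 : ℝ) ^ ((0 : ℤ) - 1))⁻¹ := by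
    rw [zpow_sub₀ two_ne_zero, zpow_sub₀ two_ne_zero]
    field_simp
  rw [dyadicCutoff, dyadicCutoff, smul_smul, smul_smul, inv_mul_cancel₀ h0, h1]
  simp

lemma dyadicCutoff_zero (η : EuclideanSpace ℝ (Fin n)) :
    dyadicCutoff φ 0 η = φ η - φ ((2 : ℝ) • η) := by
  simp [dyadicCutoff]

lemma continuous_dyadicCutoff (hφ : Continuous φ) (j : ℤ) : Continuous (dyadicCutoff φ j) := by
  unfold dyadicCutoff
  fun_prop

lemma dyadicCutoff_zero_eq_zero (hφ1 : ∀ ξ, ‖ξ‖ ≤ 1 → φ ξ = 1) {η : EuclideanSpace ℝ (Fin n)}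
    (hη : ‖η‖ ≤ 1 / 2) : dyadicCutoff φ 0 η = 0 := by
  rw [dyadicCutoff_zero, hφ1 η (by linarith), hφ1, sub_self]
  rw [norm_smul, Real.norm_of_nonneg zero_le_two]
  linarith

lemma dyadicCutoff_zero_eq_zero_of_le (hφ0 : ∀ ξ, 2 ≤ ‖ξ‖ → φ ξ = 0)
    {η : EuclideanSpace ℝ (Fin n)} (hη : 2 ≤ ‖η‖) : dyadicCutoff φ 0 η = 0 := by
  rw [dyadicCutoff_zero, hφ0 η hη, hφ0, sub_self]
  rw [norm_smul, Real.norm_of_nonneg zero_le_two]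
  linarith

/-- Rescaling the frequency to unit size. -/
lemma localizedKernel_smul (j : ℤ) (t : ℝ) (y : EuclideanSpace ℝ (Fin n)) :
    localizedKernel α β φ j t (((2 : ℝ) ^ j)⁻¹ • y) = ((((2 : ℝ) ^ j) ^ n : ℝ) : ℂ) *
      ∫ η : EuclideanSpace ℝ (Fin n),
        mittagLeffler α (-Complex.I * ((t ^ α * ((2 : ℝ) ^ j) ^ β * ‖η‖ ^ β : ℝ) : ℂ)) *
          dyadicCutoff φ 0 η * Complex.exp (Complex.I * ((inner ℝ y η : ℝ) : ℂ)) := by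
  have hN : 0 < (2 : ℝ) ^ j := by positivity
  have h := Measure.integral_comp_smul (volume : Measure (EuclideanSpace ℝ (Fin n)))
    (fun ξ => mittagLeffler α (-Complex.I * ((t ^ α * ‖ξ‖ ^ β : ℝ) : ℂ)) * dyadicCutoff φ j ξ *
      Complex.exp (Complex.I * ((inner ℝ (((2 : ℝ) ^ j)⁻¹ • y) ξ : ℝ) : ℂ))) ((2 : ℝ) ^ j)
  rw [finrank_euclideanSpace_fin, abs_of_pos (by positivity), Complex.real_smul] at h
  have hN' : ((((2 : ℝ) ^ j) ^ n : ℝ) : ℂ) ≠ 0 := by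
    exact_mod_cast (pow_pos hN n).ne'
  rw [localizedKernel, eq_comm]
  rw [Complex.ofReal_inv, eq_inv_mul_iff_mul_eq₀ hN'] at h
  rw [← h]
  congr 2
  ext η
  rw [dyadicCutoff_smul, norm_smul, Real.norm_of_nonneg hN.le,
    Real.mul_rpow hN.le (norm_nonneg _), inner_smul_left, inner_smul_right]
  simp only [map_inv₀, conj_trivial, ← mul_assoc, inv_mul_cancel₀ hN.ne', one_mul]

/-- The leading profile `|η|^(-β) ψ(η)` of the rescaled symbol. -/
noncomputable def kernelProfile (β : ℝ) (φ : EuclideanSpace ℝ (Fin n) → ℂ)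
    (η : EuclideanSpace ℝ (Fin n)) : ℂ :=
  ((‖η‖ ^ (-β) : ℝ) : ℂ) * dyadicCutoff φ 0 η

lemma continuous_kernelProfile (hφ : Continuous φ) (hφ1 : ∀ ξ, ‖ξ‖ ≤ 1 → φ ξ = 1) :
    Continuous (kernelProfile β φ) := by
  refine continuous_iff_continuousAt.2 fun η => ?_
  rcases eq_or_ne η 0 with rfl | h
  · have h0 : kernelProfile β φ =ᶠ[𝓝 0] fun _ => 0 := by
      filter_upwards [Metric.ball_mem_nhds (0 : EuclideanSpace ℝ (Fin n)) (half_pos one_pos)]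
        with η hη
      rw [kernelProfile, dyadicCutoff_zero_eq_zero hφ1 (by simpa using (mem_ball_zero_iff.1 hη).le),
        mul_zero]
    exact continuousAt_const.congr h0.symm
  · refine ContinuousAt.mul ?_ (continuous_dyadicCutoff hφ 0).continuousAt
    exact Complex.continuous_ofReal.continuousAt.comp
      (continuous_norm.continuousAt.rpow_const (Or.inl (norm_ne_zero_iff.2 h)))

lemma hasCompactSupport_kernelProfile (hφ0 : ∀ ξ, 2 ≤ ‖ξ‖ → φ ξ = 0) :
    HasCompactSupport (kernelProfile β φ) := by
  refine HasCompactSupport.of_support_subset_isCompact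
    (isCompact_closedBall (0 : EuclideanSpace ℝ (Fin n)) 2) fun η hη => ?_
  rw [mem_closedBall_zero_iff]
  by_contra! h
  exact hη (by rw [kernelProfile, dyadicCutoff_zero_eq_zero_of_le hφ0 h.le, mul_zero])

/-- By Fourier inversion, a nonzero continuous integrable function has a nonzero Fourier
coefficient. -/
lemma exists_integral_mul_cexp_ne_zero {g : EuclideanSpace ℝ (Fin n) → ℂ} (hg : Continuous g)
    (hgi : Integrable g) (hne : g ≠ 0) :
    ∃ y : EuclideanSpace ℝ (Fin n),
      ∫ η, g η * Complex.exp (Complex.I * ((inner ℝ y η : ℝ) : ℂ)) ≠ 0 := by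
  by_contra! h
  have hF : FourierTransform.fourier g = 0 := by
    ext w
    rw [Real.fourier_eq', Pi.zero_apply, ← h ((-2 * Real.pi) • w)]
    congr 1
    ext v
    rw [smul_eq_mul, mul_comm, inner_smul_left, real_inner_comm]
    congr 2
    simp only [conj_trivial]
    push_cast
    ring
  have hinv := hg.fourierInv_fourier_eq hgi (by rw [hF]; exact integrable_zero _ _ _)
  apply hne
  rw [← hinv, hF]
  ext v
  rw [Real.fourierInv_eq']
  simp

/-- The rescaled kernel, multiplied by its frequency parameter, converges to the Fourier integral of
the profile. -/
lemma tendsto_mul_integral_mittagLeffler (hα : 0 < α) (hα1 : α < 1) (hβ : 0 < β)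
    (hφ : Continuous φ) (hφ1 : ∀ ξ, ‖ξ‖ ≤ 1 → φ ξ = 1) (hφ0 : ∀ ξ, 2 ≤ ‖ξ‖ → φ ξ = 0)
    (y : EuclideanSpace ℝ (Fin n)) :
    Tendsto (fun Λ : ℝ => (Λ : ℂ) * ∫ η : EuclideanSpace ℝ (Fin n),
        mittagLeffler α (-Complex.I * ((Λ * ‖η‖ ^ β : ℝ) : ℂ)) * dyadicCutoff φ 0 η *
          Complex.exp (Complex.I * ((inner ℝ y η : ℝ) : ℂ))) atTop
      (𝓝 ((Complex.I * Real.Gamma (1 - α))⁻¹ *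
        ∫ η, kernelProfile β φ η * Complex.exp (Complex.I * ((inner ℝ y η : ℝ) : ℂ)))) := by
  set L := (Complex.I * Real.Gamma (1 - α))⁻¹
  set M : ℝ → ℂ := fun s => mittagLeffler α (-Complex.I * s) with hM
  have hlim : Tendsto (fun s : ℝ => (s : ℂ) * M s) atTop (𝓝 L) := tendsto_mul_mittagLeffler hα hα1
  obtain ⟨s₀, hs₀⟩ := eventually_atTop.1 (hlim.norm.eventually_le_const (lt_add_one ‖L‖))
  have hexp : ∀ η : EuclideanSpace ℝ (Fin n),
      ‖Complex.exp (Complex.I * ((inner ℝ y η : ℝ) : ℂ))‖ = 1 := fun η => by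
    rw [mul_comm, Complex.norm_exp_ofReal_mul_I]
  -- away from the origin the integrand depends on `Λ` only through `s ↦ s * M s`
  have hrew : ∀ (Λ : ℝ) (η : EuclideanSpace ℝ (Fin n)), η ≠ 0 →
      (Λ : ℂ) * (M (Λ * ‖η‖ ^ β) * dyadicCutoff φ 0 η *
        Complex.exp (Complex.I * ((inner ℝ y η : ℝ) : ℂ))) =
      (((Λ * ‖η‖ ^ β : ℝ) : ℂ) * M (Λ * ‖η‖ ^ β)) *
        (kernelProfile β φ η * Complex.exp (Complex.I * ((inner ℝ y η : ℝ) : ℂ))) := by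
    intro Λ η hη
    have hp := Real.rpow_pos_of_pos (norm_pos_iff.2 hη) β
    have hp' : ((‖η‖ ^ β : ℝ) : ℂ) ≠ 0 := by exact_mod_cast hp.ne'
    rw [kernelProfile, Real.rpow_neg (norm_nonneg _), Complex.ofReal_inv, Complex.ofReal_mul]
    field_simp
  have hgi : Integrable (kernelProfile β φ) :=
    (continuous_kernelProfile hφ hφ1).integrable_of_hasCompactSupport
      (hasCompactSupport_kernelProfile hφ0)
  have hψ0 : dyadicCutoff φ 0 0 = 0 := dyadicCutoff_zero_eq_zero hφ1 (by simp)
  simp only [← integral_const_mul]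
  refine tendsto_integral_filter_of_dominated_convergence
    (fun η => (‖L‖ + 1) * ‖kernelProfile β φ η‖) ?_ ?_ (hgi.norm.const_mul _) ?_
  · refine Eventually.of_forall fun Λ => Measurable.aestronglyMeasurable ?_
    have h1 : Measurable fun η : EuclideanSpace ℝ (Fin n) => M (Λ * ‖η‖ ^ β) :=
      (measurable_mittagLeffler hα).comp (by fun_prop)
    have h2 := (continuous_dyadicCutoff hφ 0).measurable
    have h3 : Measurable fun η : EuclideanSpace ℝ (Fin n) =>
        Complex.exp (Complex.I * ((inner ℝ y η : ℝ) : ℂ)) :=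
      (by fun_prop : Continuous fun η : EuclideanSpace ℝ (Fin n) =>
        Complex.exp (Complex.I * ((inner ℝ y η : ℝ) : ℂ))).measurable
    exact ((h1.mul h2).mul h3).const_mul _
  · filter_upwards [eventually_ge_atTop (max 0 (s₀ / (1 / 2) ^ β))] with Λ hΛ
    refine Eventually.of_forall fun η => ?_
    rcases le_total ‖η‖ (1 / 2) with h | h
    · rw [dyadicCutoff_zero_eq_zero hφ1 h]
      simp only [mul_zero, zero_mul, norm_zero]
      positivity
    · have hη : η ≠ 0 := norm_pos_iff.1 (by linarith)
      rw [hrew Λ η hη, norm_mul, norm_mul (kernelProfile β φ η), hexp, mul_one]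
      refine mul_le_mul_of_nonneg_right (hs₀ _ ?_) (norm_nonneg _)
      have h1 : s₀ ≤ Λ * (1 / 2) ^ β :=
        (div_le_iff₀ (by positivity)).1 ((le_max_right _ _).trans hΛ)
      exact h1.trans (mul_le_mul_of_nonneg_left (Real.rpow_le_rpow (by norm_num) h hβ.le)
        ((le_max_left _ _).trans hΛ))
  · refine Eventually.of_forall fun η => ?_
    rcases eq_or_ne η 0 with rfl | hη
    · simp [kernelProfile, hψ0]
    · have hp := Real.rpow_pos_of_pos (norm_pos_iff.2 hη) β
      refine ((hlim.comp (tendsto_id.atTop_mul_const hp)).mul_const _).congr fun Λ => ?_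
      exact (hrew Λ η hη).symm

/-- The phase has modulus one, so the integral of the modulus of the symbol bounds every value. -/
lemma bddAbove_range_norm_localizedKernel (α β : ℝ) (φ : EuclideanSpace ℝ (Fin n) → ℂ) (j : ℤ)
    (t : ℝ) : BddAbove (Set.range fun x => ‖localizedKernel α β φ j t x‖) := by
  refine ⟨∫ ξ, ‖mittagLeffler α (-Complex.I * ((t ^ α * ‖ξ‖ ^ β : ℝ) : ℂ)) *
    dyadicCutoff φ j ξ‖, ?_⟩
  rintro _ ⟨x, rfl⟩
  refine (norm_integral_le_integral_norm _).trans (le_of_eq ?_)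
  congr 1
  ext ξ
  rw [norm_mul _ (Complex.exp _), mul_comm Complex.I, Complex.norm_exp_ofReal_mul_I, mul_one]

end Kernel

theorem mainTheorem2 (n : ℕ) (hn : 1 ≤ n) (α β : ℝ) (hα0 : 0 < α) (hα1 : α < 1) (hβ : 0 < β)
    (φ : EuclideanSpace ℝ (Fin n) → ℂ) (hφ : ContDiff ℝ ∞ φ) (hφc : HasCompactSupport φ)
    (hφ1 : ∀ ξ, ‖ξ‖ ≤ 1 → φ ξ = 1) (hφ0 : ∀ ξ, 2 ≤ ‖ξ‖ → φ ξ = 0) :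
    ∃ c t₀ N₀ : ℝ, 0 < c ∧ 0 < t₀ ∧ 0 < N₀ ∧
      ∀ (t N : ℝ) (j : ℤ), N = (2 : ℝ) ^ j → t₀ < t → N₀ < N →
        BddAbove (Set.range fun x => ‖localizedKernel α β φ j t x‖) ∧
        c * (N ^ n / (1 + t ^ α * N ^ β)) ≤ ⨆ x, ‖localizedKernel α β φ j t x‖ := by
  have hφcont := hφ.continuous
  have hg := continuous_kernelProfile (β := β) hφcont hφ1
  have hne : kernelProfile β φ ≠ 0 := by
    intro h
    have hu : ‖EuclideanSpace.single (⟨0, hn⟩ : Fin n) (1 : ℝ)‖ = 1 := by simp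
    have h1 := congrFun h (EuclideanSpace.single (⟨0, hn⟩ : Fin n) (1 : ℝ))
    rw [kernelProfile, dyadicCutoff_zero, hu, hφ1 _ hu.le, hφ0] at h1
    · simp at h1
    · rw [norm_smul, hu]
      simp
  obtain ⟨y, hy⟩ := exists_integral_mul_cexp_ne_zero hg
    (hg.integrable_of_hasCompactSupport (hasCompactSupport_kernelProfile hφ0)) hne
  have hlim := (tendsto_mul_integral_mittagLeffler hα0 hα1 hβ hφcont hφ1 hφ0 y).norm
  set B := ‖(Complex.I * Real.Gamma (1 - α) : ℂ)⁻¹ *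
    ∫ η, kernelProfile β φ η * Complex.exp (Complex.I * ((inner ℝ y η : ℝ) : ℂ))‖
  have hΓ : (Real.Gamma (1 - α) : ℂ) ≠ 0 := by
    exact_mod_cast (Real.Gamma_pos_of_pos (by linarith)).ne'
  have hB : 0 < B := norm_pos_iff.2 (mul_ne_zero (inv_ne_zero (mul_ne_zero Complex.I_ne_zero hΓ)) hy)
  obtain ⟨Λ₀, hΛ₀⟩ := eventually_atTop.1 (hlim.eventually_const_le (half_lt_self hB))
  -- for `N > 1` this lower bound on `t` gives `t ^ α * N ^ β ≥ max 1 Λ₀`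
  refine ⟨B / 2, (max 1 Λ₀) ^ α⁻¹, 1, half_pos hB, by positivity, one_pos, ?_⟩
  rintro t N j rfl ht hN
  refine ⟨bddAbove_range_norm_localizedKernel α β φ j t, ?_⟩
  refine le_trans ?_ (le_ciSup (bddAbove_range_norm_localizedKernel α β φ j t)
    (((2 : ℝ) ^ j)⁻¹ • y))
  have hm : (0 : ℝ) < max 1 Λ₀ := by positivity
  have ht1 : max 1 Λ₀ ≤ t ^ α := by
    have h := Real.rpow_le_rpow (by positivity) ht.le hα0.le
    rwa [← Real.rpow_mul hm.le, inv_mul_cancel₀ hα0.ne', Real.rpow_one] at h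
  have hNβ : 1 ≤ ((2 : ℝ) ^ j) ^ β := Real.one_le_rpow hN.le hβ.le
  set Λ := t ^ α * ((2 : ℝ) ^ j) ^ β with hΛ
  have hΛ1 : max 1 Λ₀ ≤ Λ := ht1.trans (le_mul_of_one_le_right (hm.le.trans ht1) hNβ)
  have hΛpos : 0 < Λ := hm.trans_le hΛ1
  have h := hΛ₀ Λ ((le_max_right _ _).trans hΛ1)
  rw [localizedKernel_smul, ← hΛ]
  rw [norm_mul, Complex.norm_real, Real.norm_of_nonneg hΛpos.le] at h
  rw [norm_mul, Complex.norm_real, Real.norm_of_nonneg (by positivity)]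
  set A := ‖∫ η : EuclideanSpace ℝ (Fin n),
    mittagLeffler α (-Complex.I * ((Λ * ‖η‖ ^ β : ℝ) : ℂ)) * dyadicCutoff φ 0 η *
      Complex.exp (Complex.I * ((inner ℝ y η : ℝ) : ℂ))‖
  have hA : B / 2 / (1 + Λ) ≤ A := by
    rw [div_le_iff₀ (by linarith)]
    nlinarith [norm_nonneg (∫ η : EuclideanSpace ℝ (Fin n),
      mittagLeffler α (-Complex.I * ((Λ * ‖η‖ ^ β : ℝ) : ℂ)) * dyadicCutoff φ 0 η *
        Complex.exp (Complex.I * ((inner ℝ y η : ℝ) : ℂ)))]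
  calc B / 2 * (((2 : ℝ) ^ j) ^ n / (1 + Λ)) = ((2 : ℝ) ^ j) ^ n * (B / 2 / (1 + Λ)) := by ring
    _ ≤ _ := by gcongr
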